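/- The packing chromatic number $\chi_\rho(H)$ of a graph $H$ is the smallest integer $k$ such that there is a map $c : V(H)\to\{1,\dots,k\}$ for which any two distinct vertices $u,v$ with $c(u)=c(v)=i$ satisfy $d_H(u,v)>i$, where $d_H$ is the shortest-path distance. For a graph $G$ and an integer $n\ge 1$, the generalized Sierpiński graph $S^n_G$ has vertex set $V(G)^n$, and $u=(u_1,\dots,u_n)$, $v=(v_1,\dots,v_n)$ are adjacent if and only if there is $i\in\{1,\dots,n\}$ such that $u_j=v_j$ for all $j<i$, $\{u_i,v_i\}\in E(G)$, and $u_j=v_i$, $v_j=u_i$ for all $j>i$. The paw is the graph obtained by attaching a leaf to one of the vertices of a triangle. Then $$\chi_\rho(S^1_{paw})=3,\qquad 5\le \chi_\rho(S^2_{paw})\le 6,\qquad 7\le \chi_\rho(S^3_{paw})\le 8,$$ and $7\le \chi_\rho(S^n_{paw})\le 11$ for every integer $n\ge 4$. -/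

import Mathlib

namespace SierpinskiPacking

/-- An `i`-packing in `G`: a set of vertices in which any two distinct vertices are at
shortest-path distance greater than `i`. Vertices in different components have distance `⊤`. -/
def IsPacking {V : Type*} (G : SimpleGraph V) (i : ℕ) (W : Set V) : Prop :=
  ∀ u ∈ W, ∀ v ∈ W, u ≠ v → (i : ℕ∞) < G.edist u v

/-- A `k`-packing coloring of `G`: a map from the vertices to the colors `1, …, k` such that,
for each color `i`, the set of vertices of color `i` is an `i`-packing. -/
def IsPackingColoring {V : Type*} (G : SimpleGraph V) (k : ℕ) (c : V → ℕ) : Prop :=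
  (∀ v, c v ∈ Finset.Icc 1 k) ∧ ∀ i ∈ Finset.Icc 1 k, IsPacking G i {v | c v = i}

/-- The packing chromatic number of `G`: the least `k` for which `G` has a `k`-packing coloring
(`⊤` if there is none). -/
noncomputable def packingChromaticNumber {V : Type*} (G : SimpleGraph V) : ℕ∞ :=
  ⨅ k ∈ {k : ℕ | ∃ c : V → ℕ, IsPackingColoring G k c}, (k : ℕ∞)

/-- The generalized Sierpiński graph of `G` of dimension `n`: the vertices are the words of
length `n` over the vertices of `G`, and `u`, `v` are adjacent iff
`u = w x y y … y` and `v = w y x x … x` for some word `w` and some edge `{x, y}` of `G`. -/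
def generalizedSierpinski {V : Type*} (G : SimpleGraph V) (n : ℕ) :
    SimpleGraph (Fin n → V) where
  Adj u v := ∃ i : Fin n, (∀ j, j < i → u j = v j) ∧ G.Adj (u i) (v i) ∧
    ∀ j, i < j → u j = v i ∧ v j = u i
  symm := ⟨fun _ _ ⟨i, h1, h2, h3⟩ =>
    ⟨i, fun j hj => (h1 j hj).symm, h2.symm, fun j hj => ⟨(h3 j hj).2, (h3 j hj).1⟩⟩⟩
  loopless := ⟨fun _ ⟨_, _, h, _⟩ => G.loopless.irrefl _ h⟩

/-- The paw: the triangle on `1, 2, 3` with the leaf `0` attached to the vertex `1`. -/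
def paw : SimpleGraph (Fin 4) :=
  SimpleGraph.fromEdgeSet {s(1, 2), s(2, 3), s(1, 3), s(0, 1)}

end SierpinskiPacking

/-!
Lower bounds: a set of vertices of diameter at most `a` contains at most one vertex of color `a`.
Put weights on such sets, for `a = 1, …, k`, so that the sets for each color `a` cover every vertex
`v` with total weight at least `w v`; below, `w v` is the weight with which the sets for the color
`1` cover `v`. In a `k`-packing coloring, the sets that contain a vertex of their own color have
total weight at least `∑ v, w v`, so there is none if all the sets together weigh less.

Upper bounds: a graph of higher dimension consists of copies of the graph of dimension `n`, joined
by edges between their corners, with at most one such edge at each corner. If the corners of a copy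
are pairwise at distance at least `k`, then the ends of a walk of length at most `k` lie in the same
copy or in two copies joined by an edge. So repeating a `k`-packing coloring of dimension `n` in all
copies gives a packing coloring as soon as there are no conflicts across an edge joining two copies.
For the paw, `n = 4` and `k = 11` work, and the coloring can be chosen to use only the colors up to
`3`, `5` and `7` on one copy of the graphs of dimension `1`, `2` and `3`.
-/

namespace SierpinskiPacking

open SimpleGraph

section Distance

variable {V W : Type*} {G : SimpleGraph V} {H : SimpleGraph W}

theorem edist_map_le (f : G →g H) (u v : V) : H.edist (f u) (f v) ≤ G.edist u v :=
  le_iInf fun p => by simpa using (p.map f).edist_le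

theorem edist_le_succ_iff {u v : V} {r : ℕ} :
    G.edist u v ≤ (r + 1 : ℕ) ↔ G.edist u v ≤ r ∨ ∃ w, G.Adj u w ∧ G.edist w v ≤ r := by
  constructor
  · intro h
    obtain ⟨p, hp⟩ := exists_walk_of_edist_ne_top (ne_top_of_le_ne_top (ENat.natCast_ne_top _) h)
    cases p with
    | nil => simp
    | @cons _ w _ huw q =>
      rw [← hp, Walk.length_cons, Nat.cast_le, Nat.add_le_add_iff_right] at h
      exact .inr ⟨w, huw, q.edist_le.trans (by exact_mod_cast h)⟩
  · rintro (h | ⟨w, huw, hwv⟩)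
    · exact h.trans (by simp)
    · calc G.edist u v ≤ G.edist u w + G.edist w v := SimpleGraph.edist_triangle
        _ ≤ 1 + r := add_le_add (edist_eq_one_iff_adj.mpr huw).le hwv
        _ = (r + 1 : ℕ) := by rw [add_comm, Nat.cast_succ]

end Distance

section PackingColoring

variable {V W : Type*} {G : SimpleGraph V} {H : SimpleGraph W} {c : V → ℕ} {k l : ℕ}

theorem isPackingColoring_iff : IsPackingColoring G k c ↔
    (∀ v, c v ∈ Finset.Icc 1 k) ∧
      ∀ u v, u ≠ v → c u = c v → (c u : ℕ∞) < G.edist u v := by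
  refine and_congr_right fun hc => ⟨fun h u v huv hcuv => h _ (hc u) u rfl v hcuv.symm huv, ?_⟩
  rintro h _ - u rfl v hv huv
  exact h u v huv hv.symm

theorem IsPackingColoring.lt_edist (hc : IsPackingColoring G k c) {u v : V} (huv : u ≠ v)
    (hcuv : c u = c v) : (c u : ℕ∞) < G.edist u v :=
  (isPackingColoring_iff.mp hc).2 u v huv hcuv

theorem IsPackingColoring.comp {c : W → ℕ} (hc : IsPackingColoring H k c) (f : G →g H)
    (hf : Function.Injective f) (hl : ∀ v, c (f v) ≤ l) : IsPackingColoring G l (c ∘ f) :=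
  isPackingColoring_iff.mpr
    ⟨fun v => Finset.mem_Icc.mpr ⟨(Finset.mem_Icc.mp (hc.1 (f v))).1, hl v⟩,
      fun u v huv hcuv => (hc.lt_edist (hf.ne huv) hcuv).trans_le (edist_map_le f u v)⟩

theorem IsPackingColoring.mono (hc : IsPackingColoring G k c) (hkl : k ≤ l) :
    IsPackingColoring G l c :=
  hc.comp Hom.id Function.injective_id fun v => (Finset.mem_Icc.mp (hc.1 v)).2.trans hkl

theorem IsPackingColoring.packingChromaticNumber_le (hc : IsPackingColoring G k c) :
    packingChromaticNumber G ≤ k :=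
  iInf₂_le k ⟨c, hc⟩

theorem succ_le_packingChromaticNumber (h : ∀ c, ¬ IsPackingColoring G k c) :
    ((k + 1 : ℕ) : ℕ∞) ≤ packingChromaticNumber G := by
  refine le_iInf₂ fun l ⟨c, hc⟩ => ?_
  by_contra! hl
  exact h c (hc.mono (Nat.lt_succ_iff.mp (by exact_mod_cast hl)))

theorem packingChromaticNumber_le_of_injective (f : G →g H) (hf : Function.Injective f) :
    packingChromaticNumber G ≤ packingChromaticNumber H :=
  le_iInf₂ fun _ ⟨_, hc⟩ =>
    (hc.comp f hf fun v => (Finset.mem_Icc.mp (hc.1 (f v))).2).packingChromaticNumber_le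

end PackingColoring

section Clusters

variable {V : Type*} {G : SimpleGraph V} {c : V → ℕ} {k : ℕ}

/-- A weighted set of vertices, meant to have diameter at most `color`, so that a packing coloring
uses `color` at most once on it. The vertices are given by labels in `ℕ`: the set consists of the
vertices whose label is the index of a binary digit `1` of `mask`. -/
structure Cluster where
  color : ℕ
  mask : ℕ
  weight : ℕ

/-- The total weight of the clusters of color `a` containing the vertex with label `j`. -/
def coverage (L : List Cluster) (a j : ℕ) : ℕ :=
  ((L.filter fun K => K.color = a ∧ K.mask.testBit j).map Cluster.weight).sum

theorem coverage_cons (K : Cluster) (L : List Cluster) (a j : ℕ) :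
    coverage (K :: L) a j =
      (if K.color = a ∧ K.mask.testBit j then K.weight else 0) + coverage L a j := by
  unfold coverage
  split_ifs with h <;> simp [h]

variable [Fintype V]

theorem IsPackingColoring.sum_coverage_le (hc : IsPackingColoring G k c) (e : V → ℕ)
    (L : List Cluster)
    (hL : ∀ K ∈ L, ∀ u v, K.mask.testBit (e u) → K.mask.testBit (e v) → G.edist u v ≤ K.color) :
    ∑ v, coverage L (c v) (e v) ≤ (L.map Cluster.weight).sum := by
  classical
  induction L with
  | nil => simp [coverage]
  | cons K L ih =>
    rw [List.forall_mem_cons] at hL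
    have hcard : Finset.card {v | K.color = c v ∧ K.mask.testBit (e v)} ≤ 1 := by
      refine Finset.card_le_one.mpr fun u hu v hv => by_contra fun huv => ?_
      obtain ⟨hcu, hu⟩ := Finset.mem_filter_univ _ |>.mp hu
      obtain ⟨hcv, hv⟩ := Finset.mem_filter_univ _ |>.mp hv
      exact (hc.lt_edist huv (hcu.symm.trans hcv)).not_ge (hcu ▸ hL.1 u v hu hv)
    calc ∑ v, coverage (K :: L) (c v) (e v)
        = Finset.card {v | K.color = c v ∧ K.mask.testBit (e v)} * K.weight
            + ∑ v, coverage L (c v) (e v) := by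
          simp only [coverage_cons, Finset.sum_add_distrib, ← Finset.sum_filter,
            Finset.sum_const, smul_eq_mul]
      _ ≤ 1 * K.weight + (L.map Cluster.weight).sum := by gcongr; exact ih hL.2
      _ = ((K :: L).map Cluster.weight).sum := by simp

end Clusters

section Words

variable {V : Type*} {G : SimpleGraph V} {n : ℕ}

theorem generalizedSierpinski_adj_succ {u v : Fin (n + 1) → V} :
    (generalizedSierpinski G (n + 1)).Adj u v ↔
      (u 0 = v 0 ∧ (generalizedSierpinski G n).Adj (Fin.tail u) (Fin.tail v)) ∨
      (G.Adj (u 0) (v 0) ∧ (Fin.tail u = fun _ => v 0) ∧ Fin.tail v = fun _ => u 0) := by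
  constructor
  · rintro ⟨i, h_prefix, h_adj, h_suffix⟩
    induction i using Fin.cases with
    | zero =>
      exact .inr ⟨h_adj, funext fun j => (h_suffix j.succ j.succ_pos).1,
        funext fun j => (h_suffix j.succ j.succ_pos).2⟩
    | succ i =>
      exact .inl ⟨h_prefix 0 i.succ_pos, i,
        fun j hj => h_prefix j.succ (Fin.succ_lt_succ_iff.mpr hj), h_adj,
        fun j hj => h_suffix j.succ (Fin.succ_lt_succ_iff.mpr hj)⟩
  · rintro (⟨h_head, i, h_prefix, h_adj, h_suffix⟩ | ⟨h_adj, hu, hv⟩)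
    · refine ⟨i.succ, Fin.cases (fun _ => h_head) fun j hj => ?_, h_adj,
        Fin.cases (fun hj => absurd hj (Fin.not_lt_zero _)) fun j hj => ?_⟩
      · exact h_prefix j (Fin.succ_lt_succ_iff.mp hj)
      · exact h_suffix j (Fin.succ_lt_succ_iff.mp hj)
    · exact ⟨0, fun j hj => absurd hj (Fin.not_lt_zero _), h_adj,
        Fin.cases (fun hj => absurd hj (lt_irrefl _)) fun j _ => ⟨congrFun hu j, congrFun hv j⟩⟩

/-- The embedding of the graph of dimension `n` as the copy `x` in the graph of dimension
`n + 1`. -/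
def consHom (G : SimpleGraph V) (n : ℕ) (x : V) :
    generalizedSierpinski G n →g generalizedSierpinski G (n + 1) where
  toFun u := Fin.cons (α := fun _ => V) x u
  map_rel' h := generalizedSierpinski_adj_succ.mpr (.inl ⟨rfl, by simpa only [Fin.tail_cons]⟩)

theorem consHom_injective (x : V) : Function.Injective (consHom G n x) :=
  Fin.cons_right_injective (α := fun _ => V) x

theorem packingChromaticNumber_generalizedSierpinski_mono [Nonempty V] :
    Monotone fun n => packingChromaticNumber (generalizedSierpinski G n) :=
  monotone_nat_of_le_succ fun _ =>
    packingChromaticNumber_le_of_injective _ (consHom_injective (Classical.arbitrary V))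

end Words

section Copies

variable {V : Type*} {G : SimpleGraph V} {m n k : ℕ}

/-- The copy of the graph of dimension `n` in which a word lies. -/
def copyOf (u : Fin (m + n) → V) : Fin m → V := u ∘ Fin.castAdd n

/-- The position of a word in its copy of the graph of dimension `n`. -/
def position (u : Fin (m + n) → V) : Fin n → V := u ∘ Fin.natAdd m

theorem eq_of_copyOf_eq_of_position_eq {u v : Fin (m + n) → V} (hcopy : copyOf u = copyOf v)
    (hposition : position u = position v) : u = v :=
  funext <| Fin.addCases (congrFun hcopy) (congrFun hposition)

/-- The copies `p` and `q` are joined by an edge from the corner `x` of `p` to the corner `y` of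
`q`, where the corner `x` is the constant word. -/
def Crossing (G : SimpleGraph V) (p q : Fin m → V) (x y : V) : Prop :=
  G.Adj x y ∧ ∃ i, (∀ j < i, p j = q j) ∧ p i = y ∧ q i = x ∧ ∀ j, i < j → p j = x ∧ q j = y

theorem Crossing.symm {p q : Fin m → V} {x y : V} (h : Crossing G p q x y) :
    Crossing G q p y x := by
  obtain ⟨hxy, i, h_prefix, hp, hq, h_suffix⟩ := h
  exact ⟨hxy.symm, i, fun j hj => (h_prefix j hj).symm, hq, hp, fun j hj => (h_suffix j hj).symm⟩

/-- Only the last letter other than `x` in the name of a copy decides to which copy the corner `x`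
is joined. -/
theorem Crossing.unique {p q q' : Fin m → V} {x y y' : V} (h : Crossing G p q x y)
    (h' : Crossing G p q' x y') : q = q' ∧ y = y' := by
  obtain ⟨hxy, i, h_prefix, hp, hq, h_suffix⟩ := h
  obtain ⟨hxy', i', h_prefix', hp', hq', h_suffix'⟩ := h'
  obtain rfl : i = i' := by
    rcases lt_trichotomy i i' with hlt | heq | hlt
    · exact absurd ((h_suffix i' hlt).1.symm.trans hp') hxy'.ne
    · exact heq
    · exact absurd ((h_suffix' i hlt).1.symm.trans hp) hxy.ne
  obtain rfl : y = y' := hp.symm.trans hp'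
  refine ⟨funext fun j => ?_, rfl⟩
  rcases lt_trichotomy j i with hlt | rfl | hlt
  · rw [← h_prefix j hlt, h_prefix' j hlt]
  · rw [hq, hq']
  · rw [(h_suffix j hlt).2, (h_suffix' j hlt).2]

theorem copyOf_eq_or_crossing_of_adj {u v : Fin (m + n) → V}
    (h : (generalizedSierpinski G (m + n)).Adj u v) :
    (copyOf u = copyOf v ∧ (generalizedSierpinski G n).Adj (position u) (position v)) ∨
      ∃ x y, Crossing G (copyOf u) (copyOf v) x y ∧
        (position u = fun _ => x) ∧ position v = fun _ => y := by
  obtain ⟨i, h_prefix, h_adj, h_suffix⟩ := h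
  have hlt (i : Fin m) (j : Fin n) : Fin.castAdd n i < Fin.natAdd m j :=
    Fin.lt_def.mpr (by simp only [Fin.val_castAdd, Fin.val_natAdd]; omega)
  induction i using Fin.addCases with
  | left i =>
    refine .inr ⟨_, _, ⟨h_adj.symm, i, fun j hj => h_prefix _ hj, rfl, rfl, fun j hj =>
      h_suffix _ hj⟩, funext fun j => ?_, funext fun j => ?_⟩
    · exact (h_suffix _ (hlt i j)).1
    · exact (h_suffix _ (hlt i j)).2
  | right i =>
    exact .inl ⟨funext fun j => h_prefix _ (hlt j i), i,
      fun j hj => h_prefix _ (Fin.natAdd_lt_natAdd_iff m |>.mpr hj), h_adj,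
      fun j hj => h_suffix _ (Fin.natAdd_lt_natAdd_iff m |>.mpr hj)⟩

/-- The words `u` and `v` are joined by a walk of length at most `r` that changes the copy of the
graph of dimension `n` at most once. -/
def JoinedWithin (G : SimpleGraph V) (r : ℕ) (u v : Fin (m + n) → V) : Prop :=
  (copyOf u = copyOf v ∧ (generalizedSierpinski G n).edist (position u) (position v) ≤ r) ∨
    ∃ x y, Crossing G (copyOf u) (copyOf v) x y ∧
      (generalizedSierpinski G n).edist (position u) (fun _ => x) + 1 +
        (generalizedSierpinski G n).edist (fun _ => y) (position v) ≤ r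

theorem JoinedWithin.mono {r s : ℕ} {u v : Fin (m + n) → V} (h : JoinedWithin G r u v)
    (hrs : r ≤ s) : JoinedWithin G s u v := by
  have hrs' : (r : ℕ∞) ≤ s := by exact_mod_cast hrs
  exact h.imp (fun ⟨hcopy, hd⟩ => ⟨hcopy, hd.trans hrs'⟩)
    fun ⟨x, y, hxy, hd⟩ => ⟨x, y, hxy, hd.trans hrs'⟩

/-- A walk through three copies joins two corners of the second one, so it is long if the corners
are far apart. -/
theorem JoinedWithin.of_adj {r : ℕ} {u v w : Fin (m + n) → V}
    (hcorner : Pairwise fun x y : V =>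
      (r : ℕ∞) ≤ (generalizedSierpinski G n).edist (fun _ => x) (fun _ => y))
    (huw : (generalizedSierpinski G (m + n)).Adj u w) (hwv : JoinedWithin G r w v) :
    JoinedWithin G (r + 1) u v := by
  set S := generalizedSierpinski G n
  have hsucc : ((r + 1 : ℕ) : ℕ∞) = 1 + r := by rw [Nat.cast_succ, add_comm]
  rcases copyOf_eq_or_crossing_of_adj huw with ⟨hcopy', hadj⟩ | ⟨x', y', hxy', hu, hw⟩ <;>
    rcases hwv with ⟨hcopy, hd⟩ | ⟨x, y, hxy, hd⟩
  · exact .inl ⟨hcopy'.trans hcopy, edist_le_succ_iff.mpr (.inr ⟨_, hadj, hd⟩)⟩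
  · refine .inr ⟨x, y, hcopy' ▸ hxy, ?_⟩
    calc S.edist (position u) (fun _ => x) + 1 + S.edist (fun _ => y) (position v)
        ≤ 1 + S.edist (position w) (fun _ => x) + 1 + S.edist (fun _ => y) (position v) := by
          gcongr
          exact SimpleGraph.edist_triangle.trans_eq (by rw [edist_eq_one_iff_adj.mpr hadj])
      _ ≤ 1 + r := by simpa only [add_assoc] using add_le_add_right hd 1
      _ = (r + 1 : ℕ) := hsucc.symm
  · refine .inr ⟨x', y', hcopy ▸ hxy', ?_⟩
    rw [hu, ← hw, SimpleGraph.edist_self, zero_add, hsucc]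
    gcongr
  · obtain rfl : y' = x := by
      by_contra hne
      have hlt : S.edist (position w) (fun _ => x) < r :=
        (ENat.add_one_le_iff' (ENat.natCast_ne_top _)).mp (le_self_add.trans hd)
      exact (hcorner hne).not_gt (hw ▸ hlt)
    obtain ⟨hcopy, rfl⟩ := hxy'.symm.unique hxy
    refine .inl ⟨hcopy, ?_⟩
    rw [hu]
    exact (le_add_self.trans hd).trans (by simp)

theorem joinedWithin_of_edist_le
    (hcorner : Pairwise fun x y : V =>
      (k : ℕ∞) ≤ (generalizedSierpinski G n).edist (fun _ => x) (fun _ => y))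
    {r : ℕ} (hr : r ≤ k) {u v : Fin (m + n) → V}
    (h : (generalizedSierpinski G (m + n)).edist u v ≤ r) : JoinedWithin G r u v := by
  induction r generalizing u with
  | zero =>
    obtain rfl : u = v := by simpa [edist_eq_zero_iff] using h
    exact .inl ⟨rfl, by simp⟩
  | succ r ih =>
    have hrk : r ≤ k := r.le_succ.trans hr
    rcases edist_le_succ_iff.mp h with h | ⟨w, huw, hwv⟩
    · exact (ih hrk h).mono r.le_succ
    · exact .of_adj (fun _ _ hxy => (Nat.cast_le.mpr hrk).trans (hcorner hxy)) huw (ih hrk hwv)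

theorem IsPackingColoring.comp_position {c : (Fin n → V) → ℕ}
    (hc : IsPackingColoring (generalizedSierpinski G n) k c)
    (hcorner : Pairwise fun x y : V =>
      (k : ℕ∞) ≤ (generalizedSierpinski G n).edist (fun _ => x) (fun _ => y))
    (hcross : ∀ x y, G.Adj x y → ∀ u v, c u = c v → (c u : ℕ∞) ≤
      (generalizedSierpinski G n).edist u (fun _ => x) +
        (generalizedSierpinski G n).edist (fun _ => y) v) :
    IsPackingColoring (generalizedSierpinski G (m + n)) k (c ∘ position) := by
  refine isPackingColoring_iff.mpr ⟨fun u => hc.1 _, fun u v huv hcuv => not_le.mp fun hd => ?_⟩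
  have hck : c (position u) ≤ k := (Finset.mem_Icc.mp (hc.1 _)).2
  rcases joinedWithin_of_edist_le hcorner hck hd with ⟨hcopy, hd⟩ | ⟨x, y, hxy, hd⟩
  · exact (hc.lt_edist (fun h => huv (eq_of_copyOf_eq_of_position_eq hcopy h)) hcuv).not_ge hd
  · rw [add_right_comm, ENat.add_one_le_iff' (ENat.natCast_ne_top _)] at hd
    exact hd.not_ge (hcross x y hxy.1 _ _ hcuv)

end Copies

section Codes

variable {m n : ℕ} {G : SimpleGraph (Fin m)}

/-- The words of length `n` over `Fin m` as numbers in base `m`, the first letter being the most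
significant digit. -/
def wordEquiv (m n : ℕ) : (Fin n → Fin m) ≃ Fin (m ^ n) :=
  (Equiv.arrowCongr Fin.revPerm (Equiv.refl _)).trans finFunctionFinEquiv

/-- The number of a word, as a natural number. -/
def code (u : Fin n → Fin m) : ℕ := wordEquiv m n u

theorem code_lt (u : Fin n → Fin m) : code u < m ^ n := (wordEquiv m n u).isLt

theorem code_injective : Function.Injective (code : (Fin n → Fin m) → ℕ) :=
  Fin.val_injective.comp (wordEquiv m n).injective

theorem code_inj {u v : Fin n → Fin m} : code u = code v ↔ u = v := code_injective.eq_iff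

theorem sum_code (f : ℕ → ℕ) : ∑ u : Fin n → Fin m, f (code u) = ∑ i ∈ Finset.range (m ^ n), f i :=
  ((wordEquiv m n).sum_comp fun i => f i).trans (Fin.sum_univ_eq_sum_range f _)

theorem code_eq_sum (u : Fin n → Fin m) : code u = ∑ i : Fin n, (u i.rev : ℕ) * m ^ (i : ℕ) :=
  finFunctionFinEquiv_apply _

theorem code_succ (u : Fin (n + 1) → Fin m) : code u = u 0 * m ^ n + code (Fin.tail u) := by
  simp only [code_eq_sum, Fin.sum_univ_castSucc, Fin.rev_last, Fin.val_last, Fin.rev_castSucc,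
    Fin.val_castSucc, Fin.tail]
  exact add_comm _ _

theorem code_cons (x : Fin m) (u : Fin n → Fin m) :
    code (Fin.cons x u : Fin (n + 1) → Fin m) = x * m ^ n + code u := by
  rw [code_succ, Fin.cons_zero, Fin.tail_cons]

theorem code_const (x : Fin m) :
    code (fun _ : Fin n => x) = x * ∑ i ∈ Finset.range n, m ^ i := by
  rw [code_eq_sum, Finset.mul_sum, Fin.sum_univ_eq_sum_range fun i => (x : ℕ) * m ^ i]

/-- The numbers of the neighbors of the word with number `i` in the generalized Sierpiński graph
of dimension `n`: those in the same copy of the graph of dimension `n - 1`, and the one across the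
edge joining two copies. -/
def adjList (G : SimpleGraph (Fin m)) [DecidableRel G.Adj] : ℕ → ℕ → List ℕ
  | 0, _ => []
  | n + 1, i =>
    (adjList G n (i % m ^ n)).map (i / m ^ n * m ^ n + ·) ++
      ((List.finRange m ×ˢ List.finRange m).filter fun p =>
        G.Adj p.1 p.2 ∧ i = p.1 * m ^ n + p.2 * ∑ l ∈ Finset.range n, m ^ l).map
        fun p => p.2 * m ^ n + p.1 * ∑ l ∈ Finset.range n, m ^ l

theorem mem_adjList_code [DecidableRel G.Adj] {u : Fin n → Fin m} {j : ℕ} :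
    j ∈ adjList G n (code u) ↔ ∃ v, (generalizedSierpinski G n).Adj u v ∧ code v = j := by
  induction n generalizing j with
  | zero => simp [adjList, generalizedSierpinski]
  | succ n ih =>
    induction u using Fin.consCases with | _ x u
    have hpos : 0 < m ^ n := (Nat.zero_le _).trans_lt (code_lt u)
    have hdiv : code (Fin.cons x u : Fin (n + 1) → Fin m) / m ^ n = x := by
      rw [code_cons, mul_comm, Nat.mul_add_div hpos, Nat.div_eq_of_lt (code_lt u), add_zero]
    have hmod : code (Fin.cons x u : Fin (n + 1) → Fin m) % m ^ n = code u := by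
      rw [code_cons, Nat.mul_add_mod', Nat.mod_eq_of_lt (code_lt u)]
    simp only [adjList, hdiv, hmod, List.mem_append, List.mem_map, ih,
      generalizedSierpinski_adj_succ, ← code_const, ← code_cons, code_inj, Fin.exists_fin_succ_pi,
      Fin.cons_zero, Fin.tail_cons, Fin.cons_inj, List.mem_filter, List.mem_product,
      List.mem_finRange, decide_eq_true_eq, Prod.exists, true_and]
    constructor
    · rintro (⟨_, ⟨v, huv, rfl⟩, rfl⟩ | ⟨_, y, ⟨hxy, rfl, hu⟩, rfl⟩)
      · exact ⟨x, v, .inl ⟨rfl, huv⟩, code_cons x v⟩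
      · exact ⟨y, fun _ => x, .inr ⟨hxy, hu, rfl⟩, rfl⟩
    · rintro ⟨y, v, ⟨rfl, huv⟩ | ⟨hxy, hu, rfl⟩, rfl⟩
      · exact .inl ⟨_, ⟨v, huv, rfl⟩, (code_cons x v).symm⟩
      · exact .inr ⟨x, y, ⟨hxy, rfl, hu⟩, rfl⟩

end Codes

section Balls

/-- Evaluation of `f` at `i` after evaluating `i`. The definitional unfolding of `f` then always
meets the same numeral for the same number, so the kernel's cache shares its results. -/
def force (i : ℕ) (f : ℕ → ℕ) : ℕ :=
  match i with
  | 0 => f 0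
  | i + 1 => f (i + 1)

theorem force_eq (i : ℕ) (f : ℕ → ℕ) : force i f = f i := by cases i <;> rfl

/-- For a graph on labels with neighbor lists `nbrs`, the masks of the balls of radius `r + 1` from
the masks `B` of the balls of radius `r`. -/
def expand (nbrs : ℕ → List ℕ) (B : ℕ → ℕ) (i : ℕ) : ℕ :=
  (nbrs i).foldr (fun j S => force j B ||| S) (B i)

/-- The mask of the ball of radius `r` around the label `i`. -/
def ballMask (nbrs : ℕ → List ℕ) (r i : ℕ) : ℕ :=
  (expand nbrs)^[r] (2 ^ ·) i

theorem testBit_expand {nbrs : ℕ → List ℕ} {B : ℕ → ℕ} {i j : ℕ} :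
    (expand nbrs B i).testBit j ↔ (B i).testBit j ∨ ∃ l ∈ nbrs i, (B l).testBit j := by
  unfold expand
  induction nbrs i with
  | nil => simp
  | cons l L ih =>
    rw [List.foldr_cons, force_eq, Nat.testBit_or, Bool.or_eq_true, ih, List.exists_mem_cons_iff,
      or_left_comm]

theorem testBit_ballMask {V : Type*} {G : SimpleGraph V} {e : V → ℕ} {nbrs : ℕ → List ℕ}
    (hnbrs : ∀ u j, j ∈ nbrs (e u) ↔ ∃ v, G.Adj u v ∧ e v = j) (r : ℕ) {u : V} {j : ℕ} :
    (ballMask nbrs r (e u)).testBit j ↔ ∃ v, G.edist u v ≤ r ∧ e v = j := by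
  induction r generalizing u with
  | zero => simp [ballMask, Nat.testBit_two_pow, edist_eq_zero_iff]
  | succ r ih =>
    have hsucc : ballMask nbrs (r + 1) (e u) = expand nbrs (ballMask nbrs r) (e u) :=
      congrFun (Function.iterate_succ_apply' _ _ _) _
    simp only [hsucc, testBit_expand, hnbrs, ih, edist_le_succ_iff]
    grind

end Balls

section Certificates

variable {m n k : ℕ} {G : SimpleGraph (Fin m)}

theorem testBit_ballMask_code [DecidableRel G.Adj] {r : ℕ} {u v : Fin n → Fin m} :
    (ballMask (adjList G n) r (code u)).testBit (code v) ↔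
      (generalizedSierpinski G n).edist u v ≤ r := by
  simp only [testBit_ballMask fun _ _ => mem_adjList_code, code_inj, exists_eq_right]

theorem not_isPackingColoring_of_sum_weight_lt [DecidableRel G.Adj] (L : List Cluster)
    (hball : ∀ K ∈ L, ∀ i < m ^ n, K.mask.testBit i →
      K.mask &&& ballMask (adjList G n) K.color i = K.mask)
    (hcover : ∀ a ∈ Finset.Icc 1 k, ∀ i < m ^ n, coverage L 1 i ≤ coverage L a i)
    (hlt : (L.map Cluster.weight).sum < ∑ i ∈ Finset.range (m ^ n), coverage L 1 i)
    (c : (Fin n → Fin m) → ℕ) : ¬ IsPackingColoring (generalizedSierpinski G n) k c := by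
  intro hc
  refine hlt.not_ge ?_
  calc ∑ i ∈ Finset.range (m ^ n), coverage L 1 i
      = ∑ u : Fin n → Fin m, coverage L 1 (code u) := (sum_code _).symm
    _ ≤ ∑ u, coverage L (c u) (code u) :=
        Finset.sum_le_sum fun u _ => hcover _ (hc.1 u) _ (code_lt u)
    _ ≤ (L.map Cluster.weight).sum := hc.sum_coverage_le code L fun K hK u v hu hv => by
        rw [← hball K hK _ (code_lt u) hu, Nat.testBit_and, Bool.and_eq_true] at hv
        exact testBit_ballMask_code.mp hv.2

end Certificates

section Colorings

variable {m n k l : ℕ} {G : SimpleGraph (Fin m)} {f : ℕ → ℕ}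

/-- The mask of the color class `a` of the coloring `f` of the labels below `N`. -/
def colorMask (f : ℕ → ℕ) (N a : ℕ) : ℕ :=
  Nat.ofBits fun i : Fin N => decide (f i = a)

theorem testBit_colorMask_code {a : ℕ} {u : Fin n → Fin m} :
    (colorMask f (m ^ n) a).testBit (code u) ↔ f (code u) = a := by
  rw [colorMask, Nat.testBit_ofBits_lt _ _ (code_lt u), decide_eq_true_iff]

theorem isPackingColoring_comp_code [DecidableRel G.Adj]
    (hcolor : ∀ i < m ^ n, f i ∈ Finset.Icc 1 k)
    (hsep : ∀ i < m ^ n,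
      ballMask (adjList G n) (f i) i &&& force (f i) (colorMask f (m ^ n)) = 2 ^ i) :
    IsPackingColoring (generalizedSierpinski G n) k (f ∘ code) := by
  refine isPackingColoring_iff.mpr ⟨fun u => hcolor _ (code_lt u), fun u v huv hcuv => ?_⟩
  refine not_le.mp fun hd => huv (code_injective ?_)
  have hv : (2 ^ code u).testBit (code v) := by
    rw [← hsep _ (code_lt u), force_eq, Nat.testBit_and, Bool.and_eq_true]
    exact ⟨testBit_ballMask_code.mpr hd, testBit_colorMask_code.mpr hcuv.symm⟩
  exact of_decide_eq_true (Nat.testBit_two_pow ▸ hv)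

theorem lt_edist_of_ballMask_and_colorMask_eq_zero [DecidableRel G.Adj] {r : ℕ}
    {u v : Fin n → Fin m}
    (h : ballMask (adjList G n) r (code u) &&& colorMask f (m ^ n) (f (code v)) = 0) :
    (r : ℕ∞) < (generalizedSierpinski G n).edist u v := by
  refine not_le.mp fun hd => ?_
  have hv := congrArg (Nat.testBit · (code v)) h
  simp only [Nat.testBit_and, Nat.zero_testBit, testBit_ballMask_code.mpr hd,
    testBit_colorMask_code.mpr, Bool.and_self, Bool.true_eq_false] at hv

theorem le_edist_add_edist_of_ballMask [DecidableRel G.Adj] {x y : Fin m}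
    {u v : Fin n → Fin m} (hcuv : f (code u) = f (code v))
    (h : ∀ i < f (code u),
      ballMask (adjList G n) i (code fun _ : Fin n => x) &&&
          colorMask f (m ^ n) (f (code u)) = 0 ∨
        ballMask (adjList G n) (f (code u) - 1 - i) (code fun _ : Fin n => y) &&&
          colorMask f (m ^ n) (f (code u)) = 0) :
    (f (code u) : ℕ∞) ≤ (generalizedSierpinski G n).edist u (fun _ => x) +
      (generalizedSierpinski G n).edist (fun _ => y) v := by
  by_contra! hlt
  obtain ⟨hx, hy⟩ := WithTop.add_ne_top.mp hlt.ne_top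
  obtain ⟨i, hi⟩ := ENat.ne_top_iff_exists.mp hx
  obtain ⟨j, hj⟩ := ENat.ne_top_iff_exists.mp hy
  have hij : i + j < f (code u) := by rw [← hi, ← hj] at hlt; exact_mod_cast hlt
  rcases h i (by omega) with hx | hy
  · have hxu := lt_edist_of_ballMask_and_colorMask_eq_zero hx
    rw [SimpleGraph.edist_comm, ← hi] at hxu
    exact hxu.false
  · have hyv := lt_edist_of_ballMask_and_colorMask_eq_zero (hcuv ▸ hy)
    rw [← hj, Nat.cast_lt] at hyv
    omega

theorem IsPackingColoring.of_comp_code_succ [NeZero m]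
    (hc : IsPackingColoring (generalizedSierpinski G (n + 1)) k (f ∘ code))
    (hl : ∀ i < m ^ n, f i ≤ l) : IsPackingColoring (generalizedSierpinski G n) l (f ∘ code) := by
  have hcode (u : Fin n → Fin m) : code (consHom G n 0 u) = code u :=
    (code_cons 0 u).trans (by simp)
  have hcomp : (f ∘ code) ∘ consHom G n 0 = f ∘ code := funext fun u => congrArg f (hcode u)
  exact hcomp ▸ hc.comp _ (consHom_injective 0) fun u =>
    (congrArg f (hcode u)).trans_le (hl _ (code_lt u))

end Colorings

section Paw

theorem paw_adj {x y : Fin 4} : paw.Adj x y ↔ x ≠ y ∧ (x = 0 → y = 1) ∧ (y = 0 → x = 1) := by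
  fin_cases x <;> fin_cases y <;> simp [paw]

instance : DecidableRel paw.Adj := fun _ _ => decidable_of_iff _ paw_adj.symm

/-- Clusters in dimension `1` covering the triangle for each of the colors `1` and `2`. -/
def clusters₁ : List Cluster := [⟨1, 0xe, 1⟩, ⟨2, 0xe, 1⟩]

theorem three_le_packingChromaticNumber_paw_one :
    3 ≤ packingChromaticNumber (generalizedSierpinski paw 1) :=
  succ_le_packingChromaticNumber <| not_isPackingColoring_of_sum_weight_lt clusters₁
    (by decide +kernel) (by decide +kernel) (by decide +kernel)

/-- Clusters in dimension `2` covering the same eight vertices for each of the colors `1, …, 4`. -/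
def clusters₂ : List Cluster :=
  [⟨1, 0xe0, 1⟩, ⟨1, 0xe00, 1⟩, ⟨1, 0x6000, 1⟩, ⟨2, 0x20e0, 1⟩, ⟨2, 0x4e00, 1⟩, ⟨3, 0xeee0, 1⟩,
   ⟨4, 0xfef0, 1⟩]

theorem five_le_packingChromaticNumber_paw_two :
    5 ≤ packingChromaticNumber (generalizedSierpinski paw 2) :=
  succ_le_packingChromaticNumber <| not_isPackingColoring_of_sum_weight_lt clusters₂
    (by decide +kernel) (by decide +kernel) (by decide +kernel)

/-- Clusters in dimension `3` for the colors `1, …, 6`. The weights are a feasible solution,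
scaled to integers, of the linear program dual to the fractional relaxation of packing coloring. -/
def clusters₃ : List Cluster :=
  [⟨1, 0xe00000, 11⟩, ⟨1, 0xc00000, 1⟩, ⟨1, 0xe000000, 15⟩, ⟨1, 0xe0000000, 18⟩,
   ⟨1, 0x3000000000, 3⟩, ⟨1, 0xe000000000, 9⟩, ⟨1, 0xe0000000000, 5⟩, ⟨1, 0xa0000000000, 1⟩,
   ⟨1, 0x300000000000, 3⟩, ⟨1, 0xe00000000000, 6⟩, ⟨1, 0x400800000000000, 3⟩,
   ⟨1, 0x30000000000000, 3⟩, ⟨1, 0xe0000000000000, 15⟩, ⟨1, 0x300000000000000, 3⟩,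
   ⟨1, 0xe00000000000000, 9⟩, ⟨1, 0xe000000000000000, 8⟩, ⟨1, 0x6000000000000000, 1⟩,
   ⟨2, 0x2e00000, 8⟩, ⟨2, 0x20e00000, 3⟩, ⟨2, 0xf400000, 1⟩, ⟨2, 0xf0800000, 1⟩,
   ⟨2, 0x200e000000, 8⟩, ⟨2, 0x4e000000, 3⟩, ⟨2, 0xf004000000, 3⟩, ⟨2, 0xe8000000, 3⟩,
   ⟨2, 0x200000e0000000, 11⟩, ⟨2, 0xf0000080000000, 3⟩, ⟨2, 0x2e000000000, 1⟩,
   ⟨2, 0xf4000000000, 5⟩, ⟨2, 0xf08000000000, 5⟩, ⟨2, 0xe80000000000, 1⟩,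
   ⟨2, 0x400e00000000000, 3⟩, ⟨2, 0x2e0000000000000, 3⟩, ⟨2, 0x20e0000000000000, 1⟩,
   ⟨2, 0xf40000000000000, 8⟩, ⟨2, 0xf080000000000000, 8⟩, ⟨2, 0x4e00000000000000, 1⟩,
   ⟨3, 0xeee00000, 12⟩, ⟨3, 0xf00000e0000000, 6⟩, ⟨3, 0xeee000000000, 6⟩, ⟨3, 0xf8e000000000, 3⟩,
   ⟨3, 0xf00e000000, 3⟩, ⟨3, 0x4fe0000000000000, 3⟩, ⟨3, 0xeee0000000000000, 9⟩,
   ⟨4, 0x200000fee00000, 9⟩, ⟨4, 0x22f20e000000, 3⟩, ⟨4, 0x20efe00000, 3⟩,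
   ⟨4, 0x22f20000e0000000, 6⟩, ⟨4, 0xefe0800000000000, 9⟩, ⟨4, 0x400fee000000000, 6⟩,
   ⟨5, 0x200020fff00000, 3⟩, ⟨5, 0xfff20e000000, 3⟩, ⟨5, 0xf0efe00000, 3⟩,
   ⟨5, 0xf00000fee00000, 6⟩, ⟨5, 0xfff20000e0000000, 6⟩, ⟨5, 0xefe0e00000000000, 3⟩,
   ⟨5, 0xe00fee000000000, 3⟩, ⟨6, 0xefe00080f8800000, 4⟩, ⟨6, 0xefe0a080e8000000, 3⟩,
   ⟨6, 0xefe0f88048000000, 1⟩, ⟨6, 0x4f40fee048000000, 1⟩, ⟨6, 0x400fff24e000000, 3⟩,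
   ⟨6, 0x22f2efe00000, 1⟩, ⟨6, 0x40fee04f400000, 1⟩, ⟨6, 0x22f20000fee00000, 1⟩,
   ⟨6, 0x2f00020fee00000, 6⟩, ⟨6, 0x22020f0eee00000, 3⟩]

theorem seven_le_packingChromaticNumber_paw_three :
    7 ≤ packingChromaticNumber (generalizedSierpinski paw 3) :=
  succ_le_packingChromaticNumber <| not_isPackingColoring_of_sum_weight_lt clusters₃
    (by decide +kernel) (by decide +kernel) (by decide +kernel)

/-- The colors of the words of length `4`, as hexadecimal digits: digit `i`, counted from the lowest
one, belongs to the word with number `i`. -/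
def pattern : ℕ :=
  0x2161412131713141512131211461513125131231412151312513123141212131 +
    0xa17321316121213151214121b316124143191281215113413572241316235218 <<< 256 +
    0x418631519121413124131321a1614131143121512171312124151281316191a1 <<< 512 +
    0x1271164112319121215132171b2112361251143281211231251312314121b191 <<< 768

/-- The color of the word of length `4` with number `i`. -/
def patternColor (i : ℕ) : ℕ := pattern >>> (4 * i) % 16

theorem isPackingColoring_patternColor_four :
    IsPackingColoring (generalizedSierpinski paw 4) 11 (patternColor ∘ code) :=
  isPackingColoring_comp_code (by decide +kernel) (by decide +kernel)

theorem isPackingColoring_patternColor_three :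
    IsPackingColoring (generalizedSierpinski paw 3) 7 (patternColor ∘ code) :=
  isPackingColoring_patternColor_four.of_comp_code_succ (by decide +kernel)

theorem isPackingColoring_patternColor_two :
    IsPackingColoring (generalizedSierpinski paw 2) 5 (patternColor ∘ code) :=
  isPackingColoring_patternColor_three.of_comp_code_succ (by decide +kernel)

theorem isPackingColoring_patternColor_one :
    IsPackingColoring (generalizedSierpinski paw 1) 3 (patternColor ∘ code) :=
  isPackingColoring_patternColor_two.of_comp_code_succ (by decide +kernel)

theorem pairwise_eleven_le_edist_corners_paw : Pairwise fun x y : Fin 4 =>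
    ((11 : ℕ) : ℕ∞) ≤ (generalizedSierpinski paw 4).edist (fun _ => x) (fun _ => y) := by
  have hball : ∀ x y : Fin 4, x ≠ y →
      ¬ (ballMask (adjList paw 4) 10 (code fun _ : Fin 4 => x)).testBit
        (code fun _ : Fin 4 => y) := by
    decide +kernel
  intro x y hxy
  exact Order.add_one_le_of_lt (not_le.mp (testBit_ballMask_code.not.mp (hball x y hxy)))

theorem patternColor_le_edist_add_edist {x y : Fin 4} (hxy : paw.Adj x y) {u v : Fin 4 → Fin 4}
    (hcuv : patternColor (code u) = patternColor (code v)) :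
    (patternColor (code u) : ℕ∞) ≤ (generalizedSierpinski paw 4).edist u (fun _ => x) +
      (generalizedSierpinski paw 4).edist (fun _ => y) v := by
  have hball : ∀ x y : Fin 4, paw.Adj x y → ∀ a ∈ Finset.Icc 1 11, ∀ i < a,
      ballMask (adjList paw 4) i (code fun _ : Fin 4 => x) &&&
          colorMask patternColor (4 ^ 4) a = 0 ∨
        ballMask (adjList paw 4) (a - 1 - i) (code fun _ : Fin 4 => y) &&&
          colorMask patternColor (4 ^ 4) a = 0 := by
    decide +kernel
  exact le_edist_add_edist_of_ballMask hcuv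
    (hball x y hxy _ (isPackingColoring_patternColor_four.1 u))

theorem isPackingColoring_patternColor_add_four (m : ℕ) :
    IsPackingColoring (generalizedSierpinski paw (m + 4)) 11 (patternColor ∘ code ∘ position) :=
  isPackingColoring_patternColor_four.comp_position pairwise_eleven_le_edist_corners_paw
    fun _ _ hxy _ _ => patternColor_le_edist_add_edist hxy

end Paw

end SierpinskiPacking

open SierpinskiPacking in
theorem mainTheorem8_general :
    packingChromaticNumber (generalizedSierpinski paw 1) = 3 ∧
    packingChromaticNumber (generalizedSierpinski paw 2) = 5 ∧
    packingChromaticNumber (generalizedSierpinski paw 3) = 7 ∧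
    ∀ n : ℕ, 4 ≤ n →
      7 ≤ packingChromaticNumber (generalizedSierpinski paw n) ∧
        packingChromaticNumber (generalizedSierpinski paw n) ≤ 11 := by
  refine ⟨?one, ?two, ?three, fun n hn => ⟨?lower, ?upper⟩⟩
  case one =>
    exact le_antisymm isPackingColoring_patternColor_one.packingChromaticNumber_le
      three_le_packingChromaticNumber_paw_one
  case two =>
    exact le_antisymm isPackingColoring_patternColor_two.packingChromaticNumber_le
      five_le_packingChromaticNumber_paw_two
  case three =>
    exact le_antisymm isPackingColoring_patternColor_three.packingChromaticNumber_le
      seven_le_packingChromaticNumber_paw_three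
  case lower =>
    exact seven_le_packingChromaticNumber_paw_three.trans
      (packingChromaticNumber_generalizedSierpinski_mono (by omega : 3 ≤ n))
  case upper =>
    obtain ⟨m, rfl⟩ := Nat.exists_eq_add_of_le' hn
    exact (isPackingColoring_patternColor_add_four m).packingChromaticNumber_le

theorem mainTheorem8 :
    SierpinskiPacking.packingChromaticNumber
        (SierpinskiPacking.generalizedSierpinski SierpinskiPacking.paw 1) = 3 ∧
    (5 ≤ SierpinskiPacking.packingChromaticNumber
        (SierpinskiPacking.generalizedSierpinski SierpinskiPacking.paw 2) ∧
      SierpinskiPacking.packingChromaticNumber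
        (SierpinskiPacking.generalizedSierpinski SierpinskiPacking.paw 2) ≤ 6) ∧
    (7 ≤ SierpinskiPacking.packingChromaticNumber
        (SierpinskiPacking.generalizedSierpinski SierpinskiPacking.paw 3) ∧
      SierpinskiPacking.packingChromaticNumber
        (SierpinskiPacking.generalizedSierpinski SierpinskiPacking.paw 3) ≤ 8) ∧
    ∀ n : ℕ, 4 ≤ n →
      7 ≤ SierpinskiPacking.packingChromaticNumber
          (SierpinskiPacking.generalizedSierpinski SierpinskiPacking.paw n) ∧
        SierpinskiPacking.packingChromaticNumber
          (SierpinskiPacking.generalizedSierpinski SierpinskiPacking.paw n) ≤ 11 := by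
  obtain ⟨h1, h2, h3, h4⟩ := mainTheorem8_general
  exact ⟨h1, ⟨h2.ge, h2.le.trans (by norm_num)⟩, ⟨h3.ge, h3.le.trans (by norm_num)⟩, h4⟩
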